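/- Let $X$ be a real Banach space. For $p>1$ let $J_p(x)=\{x^*\in X^* : \langle x^*,x\rangle=\|x\|\,\|x^*\|,\ \|x^*\|=\|x\|^{p-1}\}$ be its (set-valued) duality map, with $j_p(x)$ denoting an element of $J_p(x)$, and let $$\rho_X(\varepsilon)=\tfrac12\sup\{\|x+y\|+\|x-y\|-2 : \|x\|=1,\ \|y\|\le\varepsilon\}$$ be its modulus of smoothness ($\rho_X=0$ if $X=\{0\}$). Assume that $X$ is uniformly smooth, i.e. $\rho_X(\varepsilon)/\varepsilon\to0$ as $\varepsilon\downarrow0$, and let $s>1$. For $p>1$, $G'_p>0$ and $x,y\in X$ put $$\tilde\sigma_p(x,y)=p\,G'_p\int_0^1\frac{\max(\|x-hy\|,\|x\|)^p}{h}\,\rho_X\!\left(\frac{h\|y\|}{\max(\|x-hy\|,\|x\|)}\right)dh,$$ $$I_{s,p}(x,y)=\int_0^1 h^{s-1}\max(\|x-hy\|,\|x\|)^{p-s}\,\|y\|^s\,dh .$$ (For $x=y=0$ all right-hand sides below are read as $0$.) (a) If $\dim X\neq1$, the following five statements are equivalent, where all constants are independent of $x,y$: 1. $X$ is $s$-smooth: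 there is $G>0$ with $\|x-y\|^s\le\|x\|^s-s\langle j_s(x),y\rangle+G\|y\|^s$ for all $x,y\in X$. 2. For some $p$ with $1<p<\infty$, the duality map $J_p$ is single-valued, $J_p(x)=\{j_p(x)\}$, and there is $C>0$ with $\|j_p(x)-j_p(y)\|\le C\max(\|x\|,\|y\|)^{p-s}\|x-y\|^{s-1}$ for all $x,y\in X$. 3. The property in statement 2 holds for all $p$ with $1<p<\infty$. 4. For some $p$ with $1<p<\infty$ there is a constant $G'_p>0$ such that $\|x-y\|^p\le\|x\|^p-p\langle j_p(x),y\rangle+\tilde\sigma_p(x,y)$ for all $x,y\in X$, and there is $C>0$ with $\tilde\sigma_p(x,y)\le C\,p\,I_{s,p}(x,y)$ for all $x,y\in X$. 5. The property in statement 4 holds for all $p$ with $1<p<\infty$. (b) In every dimension (including $\dim X=1$), statements 1, 2, 3 are equivalent to each other and to each of the following: 4'. For some $p$ with $1<p<\infty$ there is $C>0$ with $\|x-y\|^p\le\|x\|^p-p\langle j_p(x),y\rangle+C\,p\,I_{s,p}(x,y)$ for all $x,y\in X$. 5'. The property in statement 4' holds for all $p$ with $1<p<\infty$. -/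

import Mathlib

open Set Filter Topology

noncomputable section

/-- The set-valued duality map `J_p` of a real normed space, with respect to `h ↦ h ^ (p - 1)`:
all `f` in the dual with `⟨f, x⟩ = ‖x‖ ‖f‖` and `‖f‖ = ‖x‖ ^ (p - 1)`. -/
def dualityMap {X : Type*} [NormedAddCommGroup X] [NormedSpace ℝ X] (p : ℝ) (x : X) :
    Set (StrongDual ℝ X) :=
  {f | f x = ‖x‖ * ‖f‖ ∧ ‖f‖ = ‖x‖ ^ (p - 1)}

/-- The modulus of smoothness `ρ_X`. For `ε ≥ 0` the set is bounded above by `2 ε`. -/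
def modulusOfSmoothness (X : Type*) [NormedAddCommGroup X] (ε : ℝ) : ℝ :=
  (1 / 2) * sSup {r : ℝ | ∃ x y : X, ‖x‖ = 1 ∧ ‖y‖ ≤ ε ∧ r = ‖x + y‖ + ‖x - y‖ - 2}

/-- `X` is uniformly smooth: `ρ_X(ε) / ε → 0` as `ε ↓ 0`. -/
def UniformlySmooth (X : Type*) [NormedAddCommGroup X] : Prop :=
  Tendsto (fun ε : ℝ => modulusOfSmoothness X ε / ε) (𝓝[>] 0) (𝓝 0)

/-- `X` is smooth of power type `s`. -/
def SmoothOfPowerType (X : Type*) [NormedAddCommGroup X] [NormedSpace ℝ X] (s : ℝ) : Prop :=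
  ∃ G : ℝ, 0 < G ∧ ∀ x y : X, ∀ f ∈ dualityMap s x,
    ‖x - y‖ ^ s ≤ ‖x‖ ^ s - s * f y + G * ‖y‖ ^ s

/-- `J_p` is single-valued, `J_p(x) = {j_p(x)}`, and
`‖j_p(x) - j_p(y)‖ ≤ C max(‖x‖, ‖y‖) ^ (p - s) ‖x - y‖ ^ (s - 1)` for all `x`, `y`. -/
def DualityMapBound (X : Type*) [NormedAddCommGroup X] [NormedSpace ℝ X] (s p : ℝ) : Prop :=
  ∃ j : X → StrongDual ℝ X, (∀ x, dualityMap p x = {j x}) ∧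
    ∃ C : ℝ, 0 < C ∧ ∀ x y : X,
      ‖j x - j y‖ ≤ C * max ‖x‖ ‖y‖ ^ (p - s) * ‖x - y‖ ^ (s - 1)

/-- The Xu-Roach remainder `σ̃_p(x, y)`, with the constant `G'_p = G`. -/
def xuRoachRemainder {X : Type*} [NormedAddCommGroup X] [NormedSpace ℝ X]
    (p G : ℝ) (x y : X) : ℝ :=
  p * G * ∫ h in (0 : ℝ)..1,
    max ‖x - h • y‖ ‖x‖ ^ p / h * modulusOfSmoothness X (h * ‖y‖ / max ‖x - h • y‖ ‖x‖)

/-- The integral `∫₀¹ h ^ (s - 1) max(‖x - h y‖, ‖x‖) ^ (p - s) ‖y‖ ^ s dh`. -/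
def powerTypeIntegral {X : Type*} [NormedAddCommGroup X] [NormedSpace ℝ X]
    (s p : ℝ) (x y : X) : ℝ :=
  ∫ h in (0 : ℝ)..1, h ^ (s - 1) * max ‖x - h • y‖ ‖x‖ ^ (p - s) * ‖y‖ ^ s

/-- The Xu-Roach inequality holds with the remainder `σ̃_p`, for some constant `G'_p > 0`,
and `σ̃_p(x, y) ≤ C p ∫₀¹ h ^ (s - 1) max(‖x - h y‖, ‖x‖) ^ (p - s) ‖y‖ ^ s dh`
for some constant `C > 0`; both for all `x`, `y`. -/
def XuRoachPowerBound (X : Type*) [NormedAddCommGroup X] [NormedSpace ℝ X] (s p : ℝ) : Prop :=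
  ∃ G : ℝ, 0 < G ∧
    (∀ x y : X, ∀ f ∈ dualityMap p x,
      ‖x - y‖ ^ p ≤ ‖x‖ ^ p - p * f y + xuRoachRemainder p G x y) ∧
    ∃ C : ℝ, 0 < C ∧ ∀ x y : X,
      xuRoachRemainder p G x y ≤ C * p * powerTypeIntegral s p x y

/-- The inequality that results when the remainder `σ̃_p` in the Xu-Roach inequality is replaced
by its upper bound. -/
def XuRoachCombined (X : Type*) [NormedAddCommGroup X] [NormedSpace ℝ X] (s p : ℝ) : Prop :=
  ∃ C : ℝ, 0 < C ∧ ∀ x y : X, ∀ f ∈ dualityMap p x,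
    ‖x - y‖ ^ p ≤ ‖x‖ ^ p - p * f y + C * p * powerTypeIntegral s p x y

end

/-!
The common core of all the properties is the growth of the modulus of smoothness: `ρ_X ε ≤ C ε ^ s`,
together with `s ≤ 2` when `X` is nontrivial. The exponent `p` does not enter it, which is why "for
some `p`" and "for all `p`" agree.

From the core to the duality map: for `x`, `z` in the unit ball, one of them of norm one, at
distance at most `t`, elements of `J_p x` and `J_p z` differ on vectors of norm at most `t` by at
most `14 ρ_X t + (p + 4) t ^ 2` (`dualityMap_sub_apply_le_of_norm_eq_one`). The first term is a sum
of second differences of the norm, the second accounts for the different norms of `x` and `z`.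
Scaling gives `dualityMap_sub_apply_le`, and since `s ≤ 2` the right-hand side is of order `t ^ s`
under the core property: this is `DualityMapBound`, for every `p`.

From the duality map to the inequalities: a bound for the variation of `J_p` along the segment from
`x` to `x - y` is integrated (`rpow_norm_sub_le_of_dualityMap_sub_le`), which yields
`XuRoachCombined`. In dimension at least two `ρ_X t` dominates `t ^ 2`
(`exists_mul_sq_le_modulusOfSmoothness`), so the estimate above is a multiple of `ρ_X t` alone and
integrates to the Xu-Roach inequality with the remainder `σ̃_p`. In dimension one `ρ_X` vanishes on
`[0, 1]`, and this step fails; in the trivial space there is nothing to prove.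

Back to the core: adding `XuRoachCombined` for `y` and `-y` removes the linear term and bounds `ρ_X`
(`XuRoachCombined.exists_modulusOfSmoothness_le`); on a ray it forces `s ≤ 2`
(`XuRoachCombined.le_two`). Finally `SmoothOfPowerType X s` is `XuRoachCombined X s p` for `p = s`,
up to the value of the constant, because the power of the maximum is then trivial.
-/

/-! ### The duality map -/

/-- The duality map has a point in every value, by the Hahn-Banach theorem. -/
lemma dualityMap_nonempty {X : Type*} [NormedAddCommGroup X] [NormedSpace ℝ X] {p : ℝ}
    (hp : 1 < p) (x : X) : (dualityMap p x).Nonempty := by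
  by_cases hx : x = 0
  · refine ⟨0, ?_⟩
    simp [dualityMap, hx, Real.zero_rpow (by linarith : p - 1 ≠ 0)]
  · obtain ⟨g, hg, hgx⟩ := exists_dual_vector ℝ x (norm_ne_zero_iff.2 hx)
    have h0 : (0 : ℝ) ≤ ‖x‖ ^ (p - 1) := by positivity
    refine ⟨‖x‖ ^ (p - 1) • g, ?_, ?_⟩
    · simp only [RCLike.ofReal_real_eq_id, id_eq] at hgx
      simp only [smul_apply, hgx, norm_smul, hg, smul_eq_mul,
        Real.norm_of_nonneg h0]
      ring
    · rw [norm_smul, hg, mul_one, Real.norm_of_nonneg h0]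

lemma dualityMap_apply_self {X : Type*} [NormedAddCommGroup X] [NormedSpace ℝ X] {p : ℝ}
    (hp : 1 < p) {x : X} {f : StrongDual ℝ X} (hf : f ∈ dualityMap p x) : f x = ‖x‖ ^ p := by
  rw [hf.1, hf.2, mul_comm, ← Real.rpow_add_one' (norm_nonneg x) (by linarith)]
  congr 1
  ring

lemma dualityMap_zero {X : Type*} [NormedAddCommGroup X] [NormedSpace ℝ X] {p : ℝ}
    (hp : 1 < p) {f : StrongDual ℝ X} (hf : f ∈ dualityMap p (0 : X)) : f = 0 := by
  have := hf.2
  rwa [norm_zero, Real.zero_rpow (by linarith), norm_eq_zero] at this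

/-- The duality map is positively homogeneous of degree `p - 1`. -/
lemma smul_mem_dualityMap {X : Type*} [NormedAddCommGroup X] [NormedSpace ℝ X] {p : ℝ}
    {x : X} {f : StrongDual ℝ X} (hf : f ∈ dualityMap p x) {c : ℝ} (hc : 0 ≤ c) :
    c ^ (p - 1) • f ∈ dualityMap p (c • x) := by
  have h0 : (0 : ℝ) ≤ c ^ (p - 1) := by positivity
  refine ⟨?_, ?_⟩
  · simp only [smul_apply, map_smul, smul_eq_mul, hf.1, norm_smul,
      Real.norm_of_nonneg hc, Real.norm_of_nonneg h0]
    ring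
  · rw [norm_smul, norm_smul, Real.norm_of_nonneg hc, Real.norm_of_nonneg h0, hf.2,
      Real.mul_rpow hc (norm_nonneg x)]

/-- An element of `J_p u`, multiplied by `p`, is a subgradient of `‖·‖ ^ p` at `u`. -/
lemma rpow_norm_add_le_of_mem_dualityMap {X : Type*} [NormedAddCommGroup X] [NormedSpace ℝ X]
    {p : ℝ} (hp : 1 < p) {u : X} {f : StrongDual ℝ X} (hf : f ∈ dualityMap p u) (v : X) :
    ‖u‖ ^ p + p * f (v - u) ≤ ‖v‖ ^ p := by
  rcases eq_or_ne u 0 with rfl | hu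
  · rw [dualityMap_zero hp hf]
    simp only [norm_zero, zero_apply, mul_zero, add_zero,
      Real.zero_rpow (by linarith : p ≠ 0)]
    positivity
  · have hu' : 0 < ‖u‖ := norm_pos_iff.2 hu
    have h1 : f v ≤ ‖u‖ ^ p * (‖v‖ / ‖u‖) := by
      calc f v ≤ ‖f‖ * ‖v‖ := (le_abs_self _).trans (f.le_opNorm v)
        _ = ‖u‖ ^ p * (‖v‖ / ‖u‖) := by
          rw [hf.2, Real.rpow_sub_one hu'.ne']; ring
    have h2 := one_add_mul_self_le_rpow_one_add (s := ‖v‖ / ‖u‖ - 1)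
      (by have : 0 ≤ ‖v‖ / ‖u‖ := by positivity
          linarith) hp.le
    rw [add_sub_cancel, Real.div_rpow (norm_nonneg _) (norm_nonneg _)] at h2
    have h3 : ‖v‖ ^ p = ‖u‖ ^ p * (‖v‖ ^ p / ‖u‖ ^ p) := by field_simp
    rw [map_sub, dualityMap_apply_self hp hf, h3]
    have h4 := mul_le_mul_of_nonneg_left h2 (by positivity : 0 ≤ ‖u‖ ^ p)
    have h5 := mul_le_mul_of_nonneg_left h1 (by linarith : 0 ≤ p)
    linarith

/-! ### The modulus of smoothness -/

lemma bddAbove_modulusOfSmoothness_set (X : Type*) [NormedAddCommGroup X] (ε : ℝ) :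
    BddAbove {r : ℝ | ∃ x y : X, ‖x‖ = 1 ∧ ‖y‖ ≤ ε ∧ r = ‖x + y‖ + ‖x - y‖ - 2} := by
  refine ⟨2 * ε, ?_⟩
  rintro _ ⟨x, y, hx, hy, rfl⟩
  linarith [norm_add_le x y, norm_sub_le x y]

lemma le_modulusOfSmoothness {X : Type*} [NormedAddCommGroup X] {x y : X} {ε : ℝ}
    (hx : ‖x‖ = 1) (hy : ‖y‖ ≤ ε) : ‖x + y‖ + ‖x - y‖ - 2 ≤ 2 * modulusOfSmoothness X ε := by
  have := le_csSup (bddAbove_modulusOfSmoothness_set X ε) ⟨x, y, hx, hy, rfl⟩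
  rw [modulusOfSmoothness]
  linarith

lemma modulusOfSmoothness_le {X : Type*} [NormedAddCommGroup X] {ε a : ℝ} (ha : 0 ≤ a)
    (h : ∀ x y : X, ‖x‖ = 1 → ‖y‖ ≤ ε → ‖x + y‖ + ‖x - y‖ - 2 ≤ 2 * a) :
    modulusOfSmoothness X ε ≤ a := by
  have : sSup {r : ℝ | ∃ x y : X, ‖x‖ = 1 ∧ ‖y‖ ≤ ε ∧ r = ‖x + y‖ + ‖x - y‖ - 2} ≤ 2 * a := by
    refine Real.sSup_le ?_ (by linarith)
    rintro _ ⟨x, y, hx, hy, rfl⟩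
    exact h x y hx hy
  rw [modulusOfSmoothness]
  linarith

lemma modulusOfSmoothness_nonneg (X : Type*) [NormedAddCommGroup X] [NormedSpace ℝ X] (ε : ℝ) :
    0 ≤ modulusOfSmoothness X ε := by
  refine mul_nonneg (by norm_num) (Real.sSup_nonneg ?_)
  rintro _ ⟨x, y, hx, hy, rfl⟩
  have h := norm_add_le (x + y) (x - y)
  have h2 : ‖(x + y) + (x - y)‖ = 2 * ‖x‖ := by
    rw [show (x + y) + (x - y) = (2 : ℝ) • x by module, norm_smul, Real.norm_two]
  linarith

lemma modulusOfSmoothness_le_self (X : Type*) [NormedAddCommGroup X] {ε : ℝ} (hε : 0 ≤ ε) :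
    modulusOfSmoothness X ε ≤ ε := by
  refine modulusOfSmoothness_le hε fun x y hx hy => ?_
  linarith [norm_add_le x y, norm_sub_le x y]

/-- The defining inequality of the modulus of smoothness, at a centre of arbitrary norm. -/
lemma norm_add_add_norm_sub_le {X : Type*} [NormedAddCommGroup X] [NormedSpace ℝ X] {x y : X}
    {ε : ℝ} (hy : ‖y‖ ≤ ε * ‖x‖) :
    ‖x + y‖ + ‖x - y‖ - 2 * ‖x‖ ≤ 2 * ‖x‖ * modulusOfSmoothness X ε := by
  rcases eq_or_ne x 0 with rfl | hx
  · have : y = 0 := by simpa using hy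
    simp [this]
  have hx' : 0 < ‖x‖ := norm_pos_iff.2 hx
  have hi : ‖‖x‖⁻¹‖ = ‖x‖⁻¹ := Real.norm_of_nonneg (by positivity)
  have h := le_modulusOfSmoothness (x := ‖x‖⁻¹ • x) (y := ‖x‖⁻¹ • y) (ε := ε)
    (by rw [norm_smul, hi, inv_mul_cancel₀ hx'.ne'])
    (by rw [norm_smul, hi, inv_mul_le_iff₀ hx', mul_comm]; exact hy)
  rw [← smul_add, ← smul_sub, norm_smul, norm_smul, hi] at h
  have h2 := mul_le_mul_of_nonneg_left h hx'.le
  have h3 : ‖x‖ * (‖x‖⁻¹ * ‖x + y‖ + ‖x‖⁻¹ * ‖x - y‖ - 2) = ‖x + y‖ + ‖x - y‖ - 2 * ‖x‖ := by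
    field_simp
  linarith

lemma modulusOfSmoothness_mono (X : Type*) [NormedAddCommGroup X] [NormedSpace ℝ X] :
    Monotone (modulusOfSmoothness X) := fun _ _ hab =>
  modulusOfSmoothness_le (modulusOfSmoothness_nonneg X _) fun _ _ hx hy =>
    le_modulusOfSmoothness hx (hy.trans hab)

/-- The modulus of smoothness is `1`-Lipschitz on the whole line; it vanishes for negative
arguments, where the supremum is taken over the empty set. -/
lemma modulusOfSmoothness_le_add_sub (X : Type*) [NormedAddCommGroup X] [NormedSpace ℝ X]
    {a b : ℝ} (hab : a ≤ b) : modulusOfSmoothness X b ≤ modulusOfSmoothness X a + (b - a) := by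
  have ha := modulusOfSmoothness_nonneg X a
  refine modulusOfSmoothness_le (by linarith) fun x y hx hy => ?_
  have hb : 0 ≤ b := (norm_nonneg y).trans hy
  rcases le_or_gt a 0 with h | h
  · linarith [norm_add_le x y, norm_sub_le x y]
  have hb' : 0 < b := by linarith
  -- the point `(a / b) • y` is admissible for `a` and lies within `b - a` of `y`
  have h1 : ‖(a / b) • y‖ ≤ a := by
    rw [norm_smul, Real.norm_of_nonneg (by positivity), div_mul_eq_mul_div, div_le_iff₀ hb']
    gcongr
  have h2 : ‖(1 - a / b) • y‖ ≤ b - a := by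
    have : 0 ≤ 1 - a / b := by rw [sub_nonneg, div_le_one hb']; exact hab
    rw [norm_smul, Real.norm_of_nonneg this]
    calc (1 - a / b) * ‖y‖ ≤ (1 - a / b) * b := by gcongr
      _ = b - a := by field_simp
  have h3 := le_modulusOfSmoothness hx h1
  have h4 : x + y = (x + (a / b) • y) + (1 - a / b) • y := by module
  have h5 : x - y = (x - (a / b) • y) - (1 - a / b) • y := by module
  rw [h4, h5]
  linarith [norm_add_le (x + (a / b) • y) ((1 - a / b) • y),
    norm_sub_le (x - (a / b) • y) ((1 - a / b) • y)]

lemma continuous_modulusOfSmoothness (X : Type*) [NormedAddCommGroup X] [NormedSpace ℝ X] :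
    Continuous (modulusOfSmoothness X) := by
  refine (LipschitzWith.of_le_add fun a b => ?_).continuous
  rcases le_total a b with h | h
  · exact (modulusOfSmoothness_mono X h).trans (le_add_of_nonneg_right dist_nonneg)
  · rw [Real.dist_eq, abs_of_nonneg (sub_nonneg.2 h)]
    exact modulusOfSmoothness_le_add_sub X h

/-- In dimension at least two the modulus of smoothness grows at least quadratically. Take a
point `u` of least norm on a Euclidean unit circle of a plane in `X`, and let `v` be `u` turned by
a right angle: both `u + τ v` and `u - τ v` have Euclidean length `√(1 + τ ^ 2)`, so their norm is
at least `√(1 + τ ^ 2) ‖u‖`. -/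
lemma exists_mul_sq_le_modulusOfSmoothness {X : Type*} [NormedAddCommGroup X] [NormedSpace ℝ X]
    (hX : 1 < Module.rank ℝ X) :
    ∃ c : ℝ, 0 < c ∧ ∀ ε : ℝ, 0 ≤ ε → ε ≤ 2 → c * ε ^ 2 ≤ modulusOfSmoothness X ε := by
  have hnt : Nontrivial X := (rank_pos_iff_nontrivial (R := ℝ)).1 (zero_lt_one.trans hX)
  obtain ⟨a, ha⟩ := exists_ne (0 : X)
  obtain ⟨b, hab⟩ := exists_linearIndependent_pair_of_one_lt_rank hX ha
  set N : ℝ → X := fun θ => Real.cos θ • a + Real.sin θ • b with hN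
  have hNc : Continuous fun θ => ‖N θ‖ := by fun_prop
  obtain ⟨θ₀, -, hmin⟩ := isCompact_Icc.exists_isMinOn
    (nonempty_Icc.2 (neg_le_self Real.pi_pos.le)) hNc.continuousOn
  have hmin' : ∀ θ ∈ Icc (-Real.pi) Real.pi, ‖N θ₀‖ ≤ ‖N θ‖ := fun θ hθ => hmin hθ
  -- comparison of the norm with the Euclidean norm of the coordinates
  have hle : ∀ α β : ℝ, ‖N θ₀‖ * √(α ^ 2 + β ^ 2) ≤ ‖α • a + β • b‖ := by
    intro α β
    set z : ℂ := ⟨α, β⟩ with hz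
    have hn : ‖z‖ = √(α ^ 2 + β ^ 2) := by
      rw [Complex.norm_def, Complex.normSq_mk]
      congr 1
      ring
    have h1 : α = ‖z‖ * Real.cos z.arg := (Complex.norm_mul_cos_arg z).symm
    have h2 : β = ‖z‖ * Real.sin z.arg := (Complex.norm_mul_sin_arg z).symm
    have h3 : α • a + β • b = ‖z‖ • N z.arg := by
      rw [hN]
      simp only [smul_add, smul_smul]
      rw [← h1, ← h2]
    rw [h3, norm_smul, norm_norm, ← hn, mul_comm]
    gcongr
    exact hmin' _ ⟨(Complex.neg_pi_lt_arg z).le, Complex.arg_le_pi z⟩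
  set u := N θ₀ with hu
  set v : X := (-Real.sin θ₀) • a + Real.cos θ₀ • b with hv
  have hcs := Real.sin_sq_add_cos_sq θ₀
  have hu0 : 0 < ‖u‖ := by
    rw [norm_pos_iff]
    intro h0
    have := LinearIndependent.pair_iff.1 hab _ _ h0
    rw [this.1, this.2] at hcs
    norm_num at hcs
  have hplus : ∀ τ : ℝ, ‖u‖ * √(1 + τ ^ 2) ≤ ‖u + τ • v‖ := by
    intro τ
    have h := hle (Real.cos θ₀ - τ * Real.sin θ₀) (Real.sin θ₀ + τ * Real.cos θ₀)
    have e1 : (Real.cos θ₀ - τ * Real.sin θ₀) ^ 2 + (Real.sin θ₀ + τ * Real.cos θ₀) ^ 2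
        = 1 + τ ^ 2 := by linear_combination (1 + τ ^ 2) * hcs
    have e2 : (Real.cos θ₀ - τ * Real.sin θ₀) • a + (Real.sin θ₀ + τ * Real.cos θ₀) • b
        = u + τ • v := by
      rw [hu, hv, hN]
      module
    rwa [e1, e2] at h
  have hv0 : ‖u‖ ≤ ‖v‖ := by
    have h := hle (-Real.sin θ₀) (Real.cos θ₀)
    rwa [neg_sq, hcs, Real.sqrt_one, mul_one] at h
  have hv1 : 0 < ‖v‖ := hu0.trans_le hv0
  refine ⟨(‖u‖ / ‖v‖) ^ 2 / 4, by positivity, fun ε hε hε2 => ?_⟩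
  set τ := ‖u‖ / ‖v‖ * ε with hτ
  have hτ0 : 0 ≤ τ := by positivity
  have hτ2 : τ ≤ 2 := by
    have : ‖u‖ / ‖v‖ ≤ 1 := (div_le_one hv1).2 hv0
    nlinarith
  have hyn : ‖τ • v‖ ≤ ε * ‖u‖ := by
    rw [norm_smul, Real.norm_of_nonneg hτ0, hτ]
    apply le_of_eq
    field_simp
  have h1 := norm_add_add_norm_sub_le hyn
  have h2 := hplus τ
  have h3 := hplus (-τ)
  rw [neg_sq, neg_smul, ← sub_eq_add_neg] at h3
  have h4 : 1 + τ ^ 2 / 4 ≤ √(1 + τ ^ 2) := by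
    apply Real.le_sqrt_of_sq_le
    nlinarith [mul_nonneg hτ0 hτ0, mul_nonneg (mul_nonneg hτ0 hτ0) (sub_nonneg.2 hτ2)]
  have h5 : ‖u‖ * (1 + τ ^ 2 / 4) ≤ ‖u‖ * √(1 + τ ^ 2) := by gcongr
  have h6 : ‖u‖ * (τ ^ 2 / 4) ≤ ‖u‖ * modulusOfSmoothness X ε := by linarith
  have h7 := le_of_mul_le_mul_left h6 hu0
  rw [hτ] at h7
  linarith [h7, mul_pow (‖u‖ / ‖v‖) ε 2]

/-! ### Differences of elements of the duality map -/

/-- Variation of norming functionals between nearby points `x` and `z`. For `w = x - z` the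
difference `f w - g w` is at most a multiple of a sum of second differences of the norm, with step
`(x - z) / 2`, along the line through `x` and `z`; the half step keeps the arguments of the modulus
of smoothness below `t` although the centres may have norm less than one. A general `w` costs one
more second difference, at `x`. -/
lemma sub_apply_le_of_norming {X : Type*} [NormedAddCommGroup X] [NormedSpace ℝ X] {x z w : X}
    {f g : StrongDual ℝ X} {t : ℝ} (hx : ‖x‖ = 1) (hz : ‖z‖ ≤ 1) (hf : ‖f‖ ≤ 1) (hfx : f x = ‖x‖)
    (hg : ‖g‖ ≤ 1) (hgz : g z = ‖z‖) (hxz : ‖x - z‖ ≤ t) (ht : t ≤ 1 / 2) (hw : ‖w‖ ≤ t) :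
    f w - g w ≤ 14 * modulusOfSmoothness X t := by
  have hfle : ∀ u, f u ≤ ‖u‖ := fun u => (le_abs_self _).trans (f.le_of_opNorm_le_of_le hf le_rfl
    |>.trans_eq (one_mul _))
  have hgle : ∀ u, g u ≤ ‖u‖ := fun u => (le_abs_self _).trans (g.le_of_opNorm_le_of_le hg le_rfl
    |>.trans_eq (one_mul _))
  have ht0 : 0 ≤ t := (norm_nonneg _).trans hw
  have hρ := modulusOfSmoothness_nonneg X t
  set ρ := modulusOfSmoothness X t with hρdef
  have hz2 : 1 / 2 ≤ ‖z‖ := by linarith [norm_sub_norm_le x z]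
  set e : X := (1 / 2 : ℝ) • (x - z) with he
  have hen : ‖e‖ ≤ t / 2 := by
    rw [he, norm_smul, Real.norm_of_nonneg (by norm_num)]
    linarith
  set m : X := x - e with hm
  have hm1 : ‖m‖ ≤ 1 := by
    have : m = (1 / 2 : ℝ) • (x + z) := by rw [hm, he]; module
    rw [this, norm_smul, Real.norm_of_nonneg (by norm_num)]
    linarith [norm_add_le x z]
  have hm2 : 1 / 2 ≤ ‖m‖ := by linarith [norm_sub_norm_le x e]
  have second : ∀ q : X, 1 / 2 ≤ ‖q‖ → ‖q‖ ≤ 1 → ‖q + e‖ + ‖q - e‖ - 2 * ‖q‖ ≤ 2 * ρ := by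
    intro q hq1 hq2
    have h := norm_add_add_norm_sub_le (x := q) (y := e) (ε := t) (by nlinarith)
    have : ‖q‖ * ρ ≤ 1 * ρ := by gcongr
    linarith
  have s0 := second x (by linarith) hx.le
  have s1 := second m hm2 hm1
  have s2 := second z hz2 hz
  rw [show m + e = x by rw [hm]; abel, show m - e = z by rw [hm, he]; module] at s1
  rw [show z + e = m by rw [hm, he]; module] at s2
  have hfe := hfle (x + e)
  have hge := hgle (z - e)
  rw [map_add] at hfe
  rw [map_sub] at hge
  have hfg : f (x - z) - g (x - z) ≤ 12 * ρ := by
    have h1 : f e = 1 / 2 * f (x - z) := by rw [he, map_smul, smul_eq_mul]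
    have h2 : g e = 1 / 2 * g (x - z) := by rw [he, map_smul, smul_eq_mul]
    linarith
  have hsec := norm_add_add_norm_sub_le (x := x) (y := w) (ε := t) (by rw [hx]; linarith)
  rw [hx] at hsec
  have hfw := hfle (x + w)
  have hgw := hgle (x - w)
  have hfz := hfle z
  simp only [map_add, map_sub] at hfw hgw hfg
  linarith

/-- `1 - r ^ q ≤ (1 + q) (1 - r)` for `q > 0` and `r ∈ [0, 1]`. -/
lemma one_sub_rpow_le {r q : ℝ} (hr : 0 ≤ r) (hr1 : r ≤ 1) (hq : 0 < q) :
    1 - r ^ q ≤ (1 + q) * (1 - r) := by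
  rcases le_total 1 q with h | h
  · have := one_add_mul_self_le_rpow_one_add (s := r - 1) (by linarith) h
    rw [add_sub_cancel] at this
    nlinarith
  · rcases hr.eq_or_lt with rfl | hr0
    · rw [Real.zero_rpow hq.ne']
      linarith
    · have := Real.rpow_le_rpow_of_exponent_ge hr0 hr1 h
      rw [Real.rpow_one] at this
      nlinarith

lemma dualityMap_sub_apply_le_of_norm_eq_one {X : Type*} [NormedAddCommGroup X] [NormedSpace ℝ X]
    {p : ℝ} (hp : 1 < p) {x z w : X} {f g : StrongDual ℝ X} {t : ℝ} (hx : ‖x‖ = 1) (hz : ‖z‖ ≤ 1)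
    (hf : f ∈ dualityMap p x) (hg : g ∈ dualityMap p z) (hxz : ‖x - z‖ ≤ t) (hw : ‖w‖ ≤ t) :
    |f w - g w| ≤ 14 * modulusOfSmoothness X t + (p + 4) * t ^ 2 := by
  -- the hypothesis on `w` is invariant under `w ↦ -w`, so a one-sided bound suffices
  suffices H : ∀ w : X, ‖w‖ ≤ t →
      f w - g w ≤ 14 * modulusOfSmoothness X t + (p + 4) * t ^ 2 by
    rw [abs_le]
    refine ⟨?_, H w hw⟩
    have := H (-w) (by rwa [norm_neg])
    rw [map_neg, map_neg] at this
    linarith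
  clear hw w
  intro w hw
  have ht0 : 0 ≤ t := (norm_nonneg _).trans hw
  have hρ := modulusOfSmoothness_nonneg X t
  have hfn : ‖f‖ = 1 := by rw [hf.2, hx, Real.one_rpow]
  have hr1 : ‖z‖ ^ (p - 1) ≤ 1 := Real.rpow_le_one (norm_nonneg _) hz (by linarith)
  have hgn : ‖g‖ ≤ 1 := hg.2.trans_le hr1
  have bound : ∀ F : StrongDual ℝ X, ‖F‖ ≤ 1 → ∀ u, |F u| ≤ ‖u‖ := fun F hF u =>
    (F.le_of_opNorm_le_of_le hF le_rfl).trans_eq (one_mul _)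
  rcases le_or_gt t (1 / 2) with ht | ht
  · have hz0 : 0 < ‖z‖ := by linarith [norm_sub_norm_le x z]
    set r := ‖z‖ ^ (p - 1) with hr
    have hr0 : 0 < r := by positivity
    have hg'n : ‖r⁻¹ • g‖ = 1 := by
      rw [norm_smul, hg.2, Real.norm_of_nonneg (by positivity), inv_mul_cancel₀ hr0.ne']
    have hg'z : (r⁻¹ • g) z = ‖z‖ := by
      rw [smul_apply, hg.1, hg.2, smul_eq_mul, ← hr]
      field_simp
    have h1 := sub_apply_le_of_norming hx hz hfn.le (by rw [hf.1, hfn, mul_one]) hg'n.le hg'z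
      hxz ht hw
    have h2 : g w = r * (r⁻¹ • g) w := by
      rw [smul_apply, smul_eq_mul]
      field_simp
    have h3 := (abs_le.1 (bound _ hg'n.le w)).2
    have h4 : 1 - r ≤ p * t := by
      have := one_sub_rpow_le (norm_nonneg z) hz (by linarith : 0 < p - 1)
      have h5 : 1 - ‖z‖ ≤ t := by linarith [norm_sub_norm_le x z]
      nlinarith
    have h6 : (1 - r) * (r⁻¹ • g) w ≤ p * t * t := by
      calc (1 - r) * (r⁻¹ • g) w ≤ (1 - r) * t :=
            mul_le_mul_of_nonneg_left (h3.trans hw) (by linarith)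
        _ ≤ p * t * t := mul_le_mul_of_nonneg_right h4 ht0
    rw [h2]
    nlinarith
  · have h1 := (abs_le.1 (bound f hfn.le w)).2
    have h2 := (abs_le.1 (bound g hgn w)).1
    nlinarith

/-- The variation of the duality map between `x` and `z`, tested against vectors of norm at most
`t ≥ ‖x - z‖`. -/
lemma dualityMap_sub_apply_le {X : Type*} [NormedAddCommGroup X] [NormedSpace ℝ X]
    {p : ℝ} (hp : 1 < p) {x z w : X} {f g : StrongDual ℝ X} {t : ℝ} (hM : 0 < max ‖x‖ ‖z‖)
    (hf : f ∈ dualityMap p x) (hg : g ∈ dualityMap p z) (hxz : ‖x - z‖ ≤ t) (hw : ‖w‖ ≤ t) :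
    f w - g w ≤ max ‖x‖ ‖z‖ ^ p * (14 * modulusOfSmoothness X (t / max ‖x‖ ‖z‖) +
      (p + 4) * (t / max ‖x‖ ‖z‖) ^ 2) := by
  set M := max ‖x‖ ‖z‖ with hMdef
  have hi : ‖M⁻¹‖ = M⁻¹ := Real.norm_of_nonneg (by positivity)
  have hn : ∀ u : X, ∀ {r : ℝ}, ‖u‖ ≤ r → ‖M⁻¹ • u‖ ≤ r / M := fun u r hu => by
    rw [norm_smul, hi, inv_mul_eq_div]
    gcongr
  have hf' := smul_mem_dualityMap hf (c := M⁻¹) (by positivity)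
  have hg' := smul_mem_dualityMap hg (c := M⁻¹) (by positivity)
  have key : |(M⁻¹ ^ (p - 1) • f) (M⁻¹ • w) - (M⁻¹ ^ (p - 1) • g) (M⁻¹ • w)| ≤
      14 * modulusOfSmoothness X (t / M) + (p + 4) * (t / M) ^ 2 := by
    have hd : ‖M⁻¹ • x - M⁻¹ • z‖ ≤ t / M := by rw [← smul_sub]; exact hn _ hxz
    rcases le_total ‖z‖ ‖x‖ with h | h
    · have hMx : M = ‖x‖ := max_eq_left h
      refine dualityMap_sub_apply_le_of_norm_eq_one hp ?_ ?_ hf' hg' hd (hn _ hw)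
      · rw [norm_smul, hi, ← hMx, inv_mul_cancel₀ hM.ne']
      · exact (hn z (h.trans_eq hMx.symm)).trans_eq (div_self hM.ne')
    · have hMz : M = ‖z‖ := max_eq_right h
      rw [abs_sub_comm]
      rw [norm_sub_rev] at hd
      refine dualityMap_sub_apply_le_of_norm_eq_one hp ?_ ?_ hg' hf' hd (hn _ hw)
      · rw [norm_smul, hi, ← hMz, inv_mul_cancel₀ hM.ne']
      · exact (hn x (h.trans_eq hMz.symm)).trans_eq (div_self hM.ne')
  have h1 : f w - g w =
      M ^ p * ((M⁻¹ ^ (p - 1) • f) (M⁻¹ • w) - (M⁻¹ ^ (p - 1) • g) (M⁻¹ • w)) := by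
    simp only [smul_apply, map_smul, smul_eq_mul]
    have h2 : M ^ p * (M⁻¹ ^ (p - 1) * M⁻¹) = 1 := by
      rw [← Real.rpow_add_one (by positivity), Real.inv_rpow hM.le, sub_add_cancel,
        mul_inv_cancel₀ (by positivity)]
    linear_combination (-(f w - g w)) * h2
  rw [h1]
  gcongr
  exact (le_abs_self _).trans key

/-! ### Integration along a segment -/

lemma half_mul_norm_le_max {X : Type*} [NormedAddCommGroup X] [NormedSpace ℝ X] (x y : X) {h : ℝ}
    (hh : 0 ≤ h) : h * ‖y‖ ≤ 2 * max ‖x - h • y‖ ‖x‖ := by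
  have h1 : h * ‖y‖ = ‖x - (x - h • y)‖ := by
    rw [sub_sub_cancel, norm_smul, Real.norm_of_nonneg hh]
  rw [h1]
  linarith [norm_sub_le x (x - h • y), le_max_left ‖x - h • y‖ ‖x‖, le_max_right ‖x - h • y‖ ‖x‖]

lemma max_norm_pos {X : Type*} [NormedAddCommGroup X] [NormedSpace ℝ X] (x : X) {y : X}
    (hy : y ≠ 0) {h : ℝ} (hh : 0 < h) : 0 < max ‖x - h • y‖ ‖x‖ := by
  have := half_mul_norm_le_max x y hh.le
  have : 0 < h * ‖y‖ := by positivity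
  linarith

lemma max_norm_le {X : Type*} [NormedAddCommGroup X] [NormedSpace ℝ X] (x y : X) {h : ℝ}
    (hh : h ∈ Ioc (0 : ℝ) 1) : max ‖x - h • y‖ ‖x‖ ≤ ‖x‖ + ‖y‖ := by
  refine max_le ((norm_sub_le _ _).trans ?_) (le_add_of_nonneg_right (norm_nonneg _))
  rw [norm_smul, Real.norm_of_nonneg hh.1.le]
  gcongr
  exact mul_le_of_le_one_left (norm_nonneg _) hh.2

lemma intervalIntegrable_of_continuousOn_of_norm_le {B : ℝ → ℝ} {K : ℝ}
    (hB : ContinuousOn B (Ioc 0 1)) (hK : ∀ h ∈ Ioc (0 : ℝ) 1, ‖B h‖ ≤ K) :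
    IntervalIntegrable B MeasureTheory.volume 0 1 := by
  rw [intervalIntegrable_iff_integrableOn_Ioc_of_le zero_le_one]
  exact MeasureTheory.IntegrableOn.of_bound (by simp)
    (hB.aestronglyMeasurable measurableSet_Ioc) K
    ((MeasureTheory.ae_restrict_iff' measurableSet_Ioc).2 (MeasureTheory.ae_of_all _ hK))

/-- A bound for the variation of the duality map along a segment integrates to an upper bound for
the remainder of `‖·‖ ^ p`. Smoothness of the norm is not needed: the right derivative of the convex
function `h ↦ ‖x - h y‖ ^ p` exists, and for every `k > h` it is bounded at `h` by `-p ⟨j, y⟩` with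
`j` in `J_p (x - k y)`; then let `k ↓ h`. -/
lemma rpow_norm_sub_le_of_dualityMap_sub_le {X : Type*} [NormedAddCommGroup X] [NormedSpace ℝ X]
    {p : ℝ} (hp : 1 < p) {x y : X} {f : StrongDual ℝ X} {B : ℝ → ℝ}
    (hBc : ContinuousOn B (Ioc 0 1)) (hBi : IntervalIntegrable B MeasureTheory.volume 0 1)
    (hB : ∀ h ∈ Ioc (0 : ℝ) 1, ∀ g ∈ dualityMap p (x - h • y), f y - g y ≤ B h) :
    ‖x - y‖ ^ p ≤ ‖x‖ ^ p - p * f y + p * ∫ h in (0 : ℝ)..1, B h := by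
  set φ : ℝ → ℝ := fun h => ‖x - h • y‖ ^ p with hφ
  have hφc : Continuous φ := by
    refine Continuous.rpow_const (by fun_prop) fun _ => Or.inr (by linarith)
  have hconv : ConvexOn ℝ univ φ := by
    refine ⟨convex_univ, fun a _ b _ α β hα hβ hαβ => ?_⟩
    have h1 : x - (α • a + β • b) • y = α • (x - a • y) + β • (x - b • y) := by
      have : x = (α + β) • x := by rw [hαβ, one_smul]
      nth_rewrite 1 [this]
      simp only [smul_eq_mul]
      module
    have h2 : ‖x - (α • a + β • b) • y‖ ≤ α * ‖x - a • y‖ + β * ‖x - b • y‖ := by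
      rw [h1]
      refine (norm_add_le _ _).trans_eq ?_
      rw [norm_smul, norm_smul, Real.norm_of_nonneg hα, Real.norm_of_nonneg hβ]
    calc φ (α • a + β • b) ≤ (α * ‖x - a • y‖ + β * ‖x - b • y‖) ^ p :=
          Real.rpow_le_rpow (norm_nonneg _) h2 (by linarith)
      _ ≤ _ := (convexOn_rpow hp.le).2 (norm_nonneg _) (norm_nonneg _) hα hβ hαβ
  have hint : IntervalIntegrable (fun h => -(p * f y) + p * B h) MeasureTheory.volume 0 1 :=
    intervalIntegrable_const.add (hBi.const_mul p)
  have main := intervalIntegral.sub_le_integral_of_hasDeriv_right_of_le zero_le_one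
    hφc.continuousOn
    (fun h _ => hconv.hasDerivWithinAt_rightDeriv_of_mem_interior (by simp : h ∈ interior univ))
    ((intervalIntegrable_iff_integrableOn_Icc_of_le zero_le_one).1 hint) (fun h hh => ?_)
  · rw [intervalIntegral.integral_add intervalIntegrable_const (hBi.const_mul p),
      intervalIntegral.integral_const_mul, intervalIntegral.integral_const] at main
    simp only [hφ, one_smul, zero_smul, sub_zero, smul_eq_mul, one_mul] at main
    linarith
  · have hlim : Tendsto (fun k => -(p * f y) + p * B k) (𝓝[>] h) (𝓝 (-(p * f y) + p * B h)) := by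
      have hBh : Tendsto B (𝓝[>] h) (𝓝 (B h)) :=
        ((hBc.continuousAt (Ioc_mem_nhds hh.1 hh.2)).tendsto).mono_left nhdsWithin_le_nhds
      exact (hBh.const_mul p).const_add _
    refine ge_of_tendsto hlim ?_
    filter_upwards [Ioo_mem_nhdsGT hh.2] with k hk
    obtain ⟨g, hg⟩ := dualityMap_nonempty hp (x - k • y)
    have hslope := hconv.rightDeriv_le_slope_of_mem_interior
      (by simp : h ∈ interior univ) (mem_univ k) hk.1
    refine hslope.trans ?_
    have hk0 : 0 < k - h := sub_pos.2 hk.1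
    have hsub := rpow_norm_add_le_of_mem_dualityMap hp hg (x - h • y)
    rw [show x - h • y - (x - k • y) = (k - h) • y by module, map_smul, smul_eq_mul] at hsub
    have hfg := mul_le_mul_of_nonneg_left (hB k ⟨hh.1.trans hk.1, hk.2.le⟩ g hg)
      (by linarith : 0 ≤ p)
    rw [slope_def_field, div_le_iff₀ hk0]
    have := mul_le_mul_of_nonneg_left hfg hk0.le
    simp only [hφ]
    linarith

/-! ### The integrands -/

lemma continuousOn_max_norm_rpow {X : Type*} [NormedAddCommGroup X] [NormedSpace ℝ X] (x : X)
    {y : X} (hy : y ≠ 0) (q : ℝ) :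
    ContinuousOn (fun h : ℝ => max ‖x - h • y‖ ‖x‖ ^ q) (Ioc 0 1) :=
  ContinuousOn.rpow_const (by fun_prop) fun _ hh => Or.inl (max_norm_pos x hy hh.1).ne'

lemma intervalIntegrable_powerType {X : Type*} [NormedAddCommGroup X] [NormedSpace ℝ X]
    {s p : ℝ} (hs : 1 < s) (hp : 1 < p) (x : X) {y : X} (hy : y ≠ 0) :
    ContinuousOn (fun h : ℝ => h ^ (s - 1) * max ‖x - h • y‖ ‖x‖ ^ (p - s) * ‖y‖ ^ s) (Ioc 0 1) ∧
    IntervalIntegrable (fun h : ℝ => h ^ (s - 1) * max ‖x - h • y‖ ‖x‖ ^ (p - s) * ‖y‖ ^ s)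
      MeasureTheory.volume 0 1 := by
  have hc : ContinuousOn (fun h : ℝ => h ^ (s - 1) * max ‖x - h • y‖ ‖x‖ ^ (p - s) * ‖y‖ ^ s)
      (Ioc 0 1) :=
    (((Real.continuous_rpow_const (by linarith)).continuousOn).mul
      (continuousOn_max_norm_rpow x hy _)).mul continuousOn_const
  refine ⟨hc, intervalIntegrable_of_continuousOn_of_norm_le
    (K := 2 ^ (s - 1) * (‖x‖ + ‖y‖) ^ (p - 1) * ‖y‖) hc fun h hh => ?_⟩
  have hM := max_norm_pos x hy hh.1
  have hM2 := max_norm_le x y hh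
  have hM3 := half_mul_norm_le_max x y hh.1.le
  have hh0 : 0 < h := hh.1
  set M := max ‖x - h • y‖ ‖x‖
  have hy0 : 0 < ‖y‖ := norm_pos_iff.2 hy
  rw [Real.norm_of_nonneg (by positivity)]
  -- the factor `M ^ (p - s)` may be singular at `h = 0`, but `h ‖y‖ ≤ 2 M`
  calc h ^ (s - 1) * M ^ (p - s) * ‖y‖ ^ s = (h * ‖y‖) ^ (s - 1) * M ^ (p - s) * ‖y‖ := by
        rw [Real.mul_rpow hh0.le hy0.le, Real.rpow_sub_one hy0.ne']
        field_simp
    _ ≤ (2 * M) ^ (s - 1) * M ^ (p - s) * ‖y‖ := by gcongr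
    _ = 2 ^ (s - 1) * M ^ (p - 1) * ‖y‖ := by
        rw [Real.mul_rpow zero_le_two hM.le, mul_assoc (2 ^ (s - 1)), ← Real.rpow_add hM]
        congr 3
        ring
    _ ≤ _ := by gcongr

lemma intervalIntegrable_xuRoach {X : Type*} [NormedAddCommGroup X] [NormedSpace ℝ X]
    {p : ℝ} (hp : 1 < p) (x : X) {y : X} (hy : y ≠ 0) :
    ContinuousOn (fun h : ℝ => max ‖x - h • y‖ ‖x‖ ^ p / h *
      modulusOfSmoothness X (h * ‖y‖ / max ‖x - h • y‖ ‖x‖)) (Ioc 0 1) ∧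
    IntervalIntegrable (fun h : ℝ => max ‖x - h • y‖ ‖x‖ ^ p / h *
      modulusOfSmoothness X (h * ‖y‖ / max ‖x - h • y‖ ‖x‖)) MeasureTheory.volume 0 1 := by
  have hc : ContinuousOn (fun h : ℝ => max ‖x - h • y‖ ‖x‖ ^ p / h *
      modulusOfSmoothness X (h * ‖y‖ / max ‖x - h • y‖ ‖x‖)) (Ioc 0 1) := by
    refine ((continuousOn_max_norm_rpow x hy p).div continuousOn_id fun h hh => hh.1.ne').mul
      ((continuous_modulusOfSmoothness X).comp_continuousOn ?_)
    exact ContinuousOn.div (by fun_prop) (by fun_prop) fun h hh => (max_norm_pos x hy hh.1).ne'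
  refine ⟨hc, intervalIntegrable_of_continuousOn_of_norm_le
    (K := (‖x‖ + ‖y‖) ^ (p - 1) * ‖y‖) hc fun h hh => ?_⟩
  have hM := max_norm_pos x hy hh.1
  have hM2 := max_norm_le x y hh
  have hh0 : 0 < h := hh.1
  set M := max ‖x - h • y‖ ‖x‖
  rw [Real.norm_of_nonneg (mul_nonneg (by positivity) (modulusOfSmoothness_nonneg X _))]
  calc M ^ p / h * modulusOfSmoothness X (h * ‖y‖ / M) ≤ M ^ p / h * (h * ‖y‖ / M) := by
        gcongr
        exact modulusOfSmoothness_le_self X (by positivity)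
    _ = M ^ (p - 1) * ‖y‖ := by
        rw [Real.rpow_sub_one hM.ne']
        field_simp
    _ ≤ _ := by gcongr

lemma powerTypeIntegral_zero {X : Type*} [NormedAddCommGroup X] [NormedSpace ℝ X]
    {s : ℝ} (hs : 1 < s) (p : ℝ) (x : X) : powerTypeIntegral s p x 0 = 0 := by
  simp [powerTypeIntegral, Real.zero_rpow (by linarith : s ≠ 0)]

lemma powerTypeIntegral_self {X : Type*} [NormedAddCommGroup X] [NormedSpace ℝ X]
    {s : ℝ} (hs : 1 < s) (x y : X) : powerTypeIntegral s s x y = ‖y‖ ^ s / s := by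
  have : (-1 : ℝ) < s - 1 := by linarith
  simp only [powerTypeIntegral, sub_self, Real.rpow_zero, mul_one,
    intervalIntegral.integral_mul_const]
  rw [integral_rpow (Or.inl this), sub_add_cancel, Real.one_rpow, Real.zero_rpow (by linarith)]
  ring

lemma powerTypeIntegral_le {X : Type*} [NormedAddCommGroup X] [NormedSpace ℝ X]
    {s p : ℝ} (hs : 1 < s) {x y : X} (hx : 1 ≤ ‖x‖) (hx2 : ‖x‖ ≤ 2)
    (hy : ∀ h ∈ Ioc (0 : ℝ) 1, ‖x - h • y‖ ≤ 2) :
    powerTypeIntegral s p x y ≤ 2 ^ |p - s| * ‖y‖ ^ s := by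
  have key : ‖powerTypeIntegral s p x y‖ ≤ 2 ^ |p - s| * ‖y‖ ^ s * |1 - 0| := by
    refine intervalIntegral.norm_integral_le_of_norm_le_const fun h hh => ?_
    rw [uIoc_of_le zero_le_one] at hh
    have hM1 : 1 ≤ max ‖x - h • y‖ ‖x‖ := hx.trans (le_max_right _ _)
    have hM2 : max ‖x - h • y‖ ‖x‖ ≤ 2 := max_le (hy h hh) hx2
    have hh0 : 0 < h := hh.1
    set M := max ‖x - h • y‖ ‖x‖
    rw [Real.norm_of_nonneg (by positivity)]
    have h1 : h ^ (s - 1) ≤ 1 := Real.rpow_le_one hh0.le hh.2 (by linarith)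
    have h2 : M ^ (p - s) ≤ 2 ^ |p - s| :=
      (Real.rpow_le_rpow_of_exponent_le hM1 (le_abs_self _)).trans
        (Real.rpow_le_rpow (by linarith) hM2 (abs_nonneg _))
    calc h ^ (s - 1) * M ^ (p - s) * ‖y‖ ^ s ≤ 1 * 2 ^ |p - s| * ‖y‖ ^ s := by gcongr
      _ = _ := by ring
  rw [sub_zero, abs_one, mul_one] at key
  exact (le_abs_self _).trans key

/-! ### Consequences of the integrated inequality -/

lemma smoothOfPowerType_iff_xuRoachCombined {X : Type*} [NormedAddCommGroup X] [NormedSpace ℝ X]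
    {s : ℝ} (hs : 1 < s) : SmoothOfPowerType X s ↔ XuRoachCombined X s s := by
  have h : ∀ (C : ℝ) (x y : X), C * s * powerTypeIntegral s s x y = C * ‖y‖ ^ s := by
    intro C x y
    rw [powerTypeIntegral_self hs]
    field_simp
  simp only [SmoothOfPowerType, XuRoachCombined, h]

lemma XuRoachPowerBound.xuRoachCombined {X : Type*} [NormedAddCommGroup X] [NormedSpace ℝ X]
    {s p : ℝ} (h : XuRoachPowerBound X s p) : XuRoachCombined X s p := by
  obtain ⟨G, -, h1, C, hC, h2⟩ := h
  exact ⟨C, hC, fun x y f hf => (h1 x y f hf).trans (by linarith [h2 x y])⟩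

lemma DualityMapBound.xuRoachCombined {X : Type*} [NormedAddCommGroup X] [NormedSpace ℝ X]
    {s p : ℝ} (hs : 1 < s) (hp : 1 < p) (h : DualityMapBound X s p) : XuRoachCombined X s p := by
  obtain ⟨j, hj, C, hC, hb⟩ := h
  refine ⟨C, hC, fun x y f hf => ?_⟩
  rcases eq_or_ne y 0 with rfl | hy
  · simp [powerTypeIntegral_zero hs]
  obtain ⟨hc, hi⟩ := intervalIntegrable_powerType hs hp x hy
  have main := rpow_norm_sub_le_of_dualityMap_sub_le hp (x := x) (y := y) (f := f)
    (B := fun h => C * (h ^ (s - 1) * max ‖x - h • y‖ ‖x‖ ^ (p - s) * ‖y‖ ^ s))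
    (continuousOn_const.mul hc) (hi.const_mul C) (fun h hh g hg => ?_)
  · rw [intervalIntegral.integral_const_mul] at main
    rw [powerTypeIntegral]
    linarith
  · rw [hj] at hf hg
    rw [mem_singleton_iff.1 hf, mem_singleton_iff.1 hg, ← sub_apply]
    have hy0 : 0 < ‖y‖ := norm_pos_iff.2 hy
    calc (j x - j (x - h • y)) y ≤ ‖j x - j (x - h • y)‖ * ‖y‖ :=
          (le_abs_self _).trans ((j x - j (x - h • y)).le_opNorm y)
      _ ≤ C * max ‖x‖ ‖x - h • y‖ ^ (p - s) * ‖x - (x - h • y)‖ ^ (s - 1) * ‖y‖ := by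
          gcongr
          exact hb _ _
      _ = _ := by
          rw [sub_sub_cancel, norm_smul, Real.norm_of_nonneg hh.1.le,
            Real.mul_rpow hh.1.le hy0.le, Real.rpow_sub_one hy0.ne', max_comm]
          field_simp

/-- On a ray the integrated inequality says that `u ↦ u ^ (p - 1)` has at `1` an increment of order
`(u - 1) ^ (s - 1)`; since the derivative there is `p - 1 ≠ 0`, this forces `s ≤ 2`. -/
lemma XuRoachCombined.le_two {X : Type*} [NormedAddCommGroup X] [NormedSpace ℝ X] [Nontrivial X]
    {s p : ℝ} (hs : 1 < s) (hp : 1 < p) (h : XuRoachCombined X s p) : s ≤ 2 := by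
  obtain ⟨C, hC, hb⟩ := h
  by_contra! hs2
  obtain ⟨e, he⟩ := exists_norm_eq X zero_le_one
  obtain ⟨fe, hfe⟩ := dualityMap_nonempty hp e
  have hfee : fe e = 1 := by rw [dualityMap_apply_self hp hfe, he, Real.one_rpow]
  set K : ℝ := 2 * C * 2 ^ |p - s| with hK
  have key : ∀ u ∈ Ioc (1 : ℝ) 2, u ^ (p - 1) - 1 ≤ K * (u - 1) ^ (s - 1) := by
    intro u hu
    have hu0 : 0 < u - 1 := sub_pos.2 hu.1
    have hun : ‖u • e‖ = u := by rw [norm_smul, he, mul_one, Real.norm_of_nonneg (by linarith)]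
    have hsegn : ∀ r ∈ Icc (-2 : ℝ) 2, ‖r • e‖ ≤ 2 := fun r hr => by
      rw [norm_smul, he, mul_one]
      exact abs_le.2 hr
    have hf := smul_mem_dualityMap hfe (by linarith [hu.1] : 0 ≤ u)
    have a1 := hb (u • e) ((u - 1) • e) _ hf
    have a2 := hb e ((1 - u) • e) _ hfe
    have b1 := powerTypeIntegral_le (p := p) hs (x := u • e) (y := (u - 1) • e)
      (hu.1.le.trans_eq hun.symm) (hun.trans_le hu.2) (fun h hh => by
        rw [show u • e - h • (u - 1) • e = (u - h * (u - 1)) • e by module]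
        refine hsegn _ ⟨?_, ?_⟩ <;> nlinarith [hh.1, hh.2, hu.1, hu.2])
    have b2 := powerTypeIntegral_le (p := p) hs (x := e) (y := (1 - u) • e)
      he.ge (he.trans_le one_le_two) (fun h hh => by
        rw [show e - h • (1 - u) • e = (1 + h * (u - 1)) • e by module]
        refine hsegn _ ⟨?_, ?_⟩ <;> nlinarith [hh.1, hh.2, hu.1, hu.2])
    rw [show u • e - (u - 1) • e = e by module] at a1
    rw [show e - (1 - u) • e = u • e by module] at a2
    have n1 : ‖(u - 1) • e‖ = u - 1 := by
      rw [norm_smul, he, mul_one, Real.norm_of_nonneg hu0.le]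
    have n2 : ‖(1 - u) • e‖ = u - 1 := by
      rw [norm_smul, he, mul_one, Real.norm_eq_abs, abs_sub_comm, abs_of_pos hu0]
    rw [n1] at b1
    rw [n2] at b2
    rw [hun, he, smul_apply, map_smul, hfee, smul_eq_mul, smul_eq_mul, mul_one] at a1
    rw [hun, he, map_smul, hfee, smul_eq_mul, mul_one] at a2
    have hCp : 0 ≤ C * p := by positivity
    have c1 := mul_le_mul_of_nonneg_left b1 hCp
    have c2 := mul_le_mul_of_nonneg_left b2 hCp
    have hpow : (u - 1) ^ s = (u - 1) ^ (s - 1) * (u - 1) := by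
      rw [Real.rpow_sub_one hu0.ne']
      field_simp
    have d : p * (u - 1) * (u ^ (p - 1) - 1) ≤ p * (u - 1) * (K * (u - 1) ^ (s - 1)) := by
      rw [hpow] at c1 c2
      rw [hK]
      linarith
    exact le_of_mul_le_mul_left d (by positivity)
  have hder : HasDerivAt (fun u : ℝ => u ^ (p - 1)) (p - 1) 1 := by
    simpa using Real.hasDerivAt_rpow_const (x := 1) (p := p - 1) (Or.inl one_ne_zero)
  have hslope := (hasDerivAt_iff_tendsto_slope.1 hder).mono_left
    (nhdsWithin_mono (1 : ℝ) (s := Ioi 1) fun u (hu : 1 < u) => hu.ne')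
  have hzero : Tendsto (fun u : ℝ => K * (u - 1) ^ (s - 2)) (𝓝[>] 1) (𝓝 0) := by
    have hcont : Continuous fun u : ℝ => K * (u - 1) ^ (s - 2) :=
      continuous_const.mul ((continuous_id.sub continuous_const).rpow_const
        fun _ => Or.inr (by linarith))
    have := (hcont.tendsto 1).mono_left (nhdsWithin_le_nhds (s := Ioi 1))
    simpa [Real.zero_rpow (by linarith : s - 2 ≠ 0)] using this
  have : p - 1 ≤ 0 := by
    refine le_of_tendsto_of_tendsto hslope hzero ?_
    filter_upwards [Ioc_mem_nhdsGT one_lt_two] with u hu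
    have hu0 : 0 < u - 1 := sub_pos.2 hu.1
    rw [slope_def_field, div_le_iff₀ hu0, Real.one_rpow]
    refine (key u hu).trans_eq ?_
    rw [show s - 1 = s - 2 + 1 by ring, Real.rpow_add_one hu0.ne']
    ring
  linarith

/-- Adding the integrated inequality for `y` and `-y` removes the linear term. -/
lemma XuRoachCombined.exists_modulusOfSmoothness_le {X : Type*} [NormedAddCommGroup X]
    [NormedSpace ℝ X] {s p : ℝ} (hs : 1 < s) (hp : 1 < p) (h : XuRoachCombined X s p) :
    ∃ C : ℝ, 0 < C ∧ ∀ ε : ℝ, 0 ≤ ε → modulusOfSmoothness X ε ≤ C * ε ^ s := by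
  obtain ⟨C, hC, hb⟩ := h
  refine ⟨C * 2 ^ |p - s| + 1, by positivity, fun ε hε => ?_⟩
  have hεs : 0 ≤ ε ^ s := by positivity
  have hK : 0 ≤ C * 2 ^ |p - s| * ε ^ s := by positivity
  rcases le_or_gt 1 ε with h1 | h1
  · have := Real.rpow_le_rpow_of_exponent_le h1 hs.le
    rw [Real.rpow_one] at this
    linarith [modulusOfSmoothness_le_self X hε]
  · refine modulusOfSmoothness_le (by positivity) fun x y hx hy => ?_
    obtain ⟨f, hf⟩ := dualityMap_nonempty hp x
    have one : ∀ w : X, ‖w‖ ≤ ε →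
        p * (‖x - w‖ - 1) + p * f w ≤ C * p * (2 ^ |p - s| * ε ^ s) := by
      intro w hw
      have a := hb x w f hf
      have b := powerTypeIntegral_le (p := p) hs (x := x) (y := w) hx.ge (hx.trans_le one_le_two)
        (fun h hh => (norm_sub_le _ _).trans (by
          rw [norm_smul, Real.norm_of_nonneg hh.1.le, hx]
          nlinarith [hh.1, hh.2, norm_nonneg w]))
      have c : ‖w‖ ^ s ≤ ε ^ s := Real.rpow_le_rpow (norm_nonneg _) hw (by linarith)
      have d := one_add_mul_self_le_rpow_one_add (s := ‖x - w‖ - 1)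
        (by linarith [norm_nonneg (x - w)]) hp.le
      rw [add_sub_cancel] at d
      rw [hx, Real.one_rpow] at a
      have e : C * p * powerTypeIntegral s p x w ≤ C * p * (2 ^ |p - s| * ε ^ s) := by
        gcongr
        exact b.trans (by gcongr)
      linarith
    have e1 := one y hy
    have e2 := one (-y) (by rwa [norm_neg])
    rw [sub_neg_eq_add, map_neg] at e2
    have e3 : p * (‖x + y‖ + ‖x - y‖ - 2) ≤ p * (2 * (C * 2 ^ |p - s| * ε ^ s)) := by linarith
    have e4 := le_of_mul_le_mul_left e3 (by linarith)
    linarith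

/-! ### From the modulus of smoothness to the duality map -/

lemma dualityMapBound_of_modulusOfSmoothness_le {X : Type*} [NormedAddCommGroup X]
    [NormedSpace ℝ X] {s p C : ℝ} (hs : 1 < s) (hp : 1 < p) (hs2 : Nontrivial X → s ≤ 2)
    (hC : 0 < C) (hρ : ∀ ε : ℝ, 0 ≤ ε → modulusOfSmoothness X ε ≤ C * ε ^ s) :
    DualityMapBound X s p := by
  set K : ℝ := 14 * C + (p + 4) * 9 with hK
  have hK0 : 0 < K := by positivity
  have main : ∀ x z : X, ∀ f ∈ dualityMap p x, ∀ g ∈ dualityMap p z,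
      ‖f - g‖ ≤ K * max ‖x‖ ‖z‖ ^ (p - s) * ‖x - z‖ ^ (s - 1) := by
    intro x z f hf g hg
    rcases (le_max_of_le_left (norm_nonneg x) : 0 ≤ max ‖x‖ ‖z‖).eq_or_lt with h0 | hM
    · have hx : x = 0 := norm_le_zero_iff.1 ((le_max_left _ _).trans_eq h0.symm)
      have hz : z = 0 := norm_le_zero_iff.1 ((le_max_right _ _).trans_eq h0.symm)
      subst hx hz
      rw [dualityMap_zero hp hf, dualityMap_zero hp hg, sub_self, norm_zero]
      positivity
    have hs2' : s ≤ 2 := by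
      refine hs2 ?_
      by_contra hn
      rw [not_nontrivial_iff_subsingleton] at hn
      rw [Subsingleton.elim x 0, Subsingleton.elim z 0] at hM
      simp at hM
    have hd : ‖x - z‖ < 3 * max ‖x‖ ‖z‖ := by
      linarith [norm_sub_le x z, le_max_left ‖x‖ ‖z‖, le_max_right ‖x‖ ‖z‖]
    set M := max ‖x‖ ‖z‖ with hMdef
    -- radii `t > ‖x - z‖`, and then `t ↓ ‖x - z‖`, so that `x = z` is covered as well
    have hcont : Continuous fun t : ℝ => K * M ^ (p - s) * t ^ (s - 1) :=
      continuous_const.mul (Real.continuous_rpow_const (by linarith))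
    refine ge_of_tendsto ((hcont.tendsto ‖x - z‖).mono_left
      (nhdsWithin_le_nhds (s := Ioi ‖x - z‖))) ?_
    filter_upwards [Ioo_mem_nhdsGT hd] with t ht
    have ht0 : 0 < t := (norm_nonneg _).trans_lt ht.1
    have hbound : ∀ w : X, ‖w‖ ≤ t → (f - g) w ≤ K * M ^ (p - s) * t ^ (s - 1) * t := by
      intro w hw
      have h1 := dualityMap_sub_apply_le hp hM hf hg ht.1.le hw
      rw [← hMdef] at h1
      have hu0 : 0 < t / M := by positivity
      have hu3 : t / M ≤ 3 := (div_le_iff₀ hM).2 ht.2.le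
      have h2 : (t / M) ^ 2 ≤ 9 * (t / M) ^ s := by
        rcases le_total (t / M) 1 with h | h
        · have := Real.rpow_le_rpow_of_exponent_ge hu0 h hs2'
          rw [Real.rpow_two] at this
          have : 0 ≤ (t / M) ^ s := by positivity
          linarith
        · have := Real.one_le_rpow h (by linarith : 0 ≤ s)
          nlinarith
      have h3 := hρ (t / M) hu0.le
      rw [sub_apply]
      calc f w - g w ≤ M ^ p * (14 * modulusOfSmoothness X (t / M) + (p + 4) * (t / M) ^ 2) := h1
        _ ≤ M ^ p * (14 * (C * (t / M) ^ s) + (p + 4) * (9 * (t / M) ^ s)) := by gcongr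
        _ = K * M ^ (p - s) * t ^ (s - 1) * t := by
          rw [Real.div_rpow ht0.le hM.le, Real.rpow_sub hM, Real.rpow_sub_one ht0.ne', hK]
          field_simp
    refine ContinuousLinearMap.opNorm_le_of_unit_norm (by positivity) fun v hv => ?_
    have htv : ‖t • v‖ ≤ t := by rw [norm_smul, hv, mul_one, Real.norm_of_nonneg ht0.le]
    have h1 := hbound (t • v) htv
    have h2 := hbound (-(t • v)) (by rwa [norm_neg])
    rw [map_neg] at h2
    rw [map_smul, smul_eq_mul, mul_comm] at h1 h2
    rw [← neg_mul] at h2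
    exact abs_le'.2 ⟨le_of_mul_le_mul_right h1 ht0, le_of_mul_le_mul_right h2 ht0⟩
  choose j hj using fun x : X => dualityMap_nonempty hp x
  refine ⟨j, fun x => Subset.antisymm (fun f hf => ?_) (singleton_subset_iff.2 (hj x)), K, hK0,
    fun x y => main x y _ (hj x) _ (hj y)⟩
  have := main x x f hf (j x) (hj x)
  rw [sub_self x, norm_zero, Real.zero_rpow (by linarith), mul_zero, norm_le_zero_iff,
    sub_eq_zero] at this
  exact this

/-! ### The Xu-Roach inequality -/

/-- The Xu-Roach inequality in dimension at least two; no smoothness is assumed. The quadratic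
error term in the variation of the duality map is absorbed by the modulus of smoothness. -/
lemma exists_rpow_norm_sub_le_add_xuRoachRemainder {X : Type*} [NormedAddCommGroup X]
    [NormedSpace ℝ X] {p : ℝ} (hp : 1 < p) (hX : 1 < Module.rank ℝ X) :
    ∃ G : ℝ, 0 < G ∧ ∀ x y : X, ∀ f ∈ dualityMap p x,
      ‖x - y‖ ^ p ≤ ‖x‖ ^ p - p * f y + xuRoachRemainder p G x y := by
  obtain ⟨c, hc, hρ⟩ := exists_mul_sq_le_modulusOfSmoothness hX
  refine ⟨14 + (p + 4) / c, by positivity, fun x y f hf => ?_⟩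
  set G : ℝ := 14 + (p + 4) / c with hG
  rcases eq_or_ne y 0 with rfl | hy
  · have : 0 ≤ xuRoachRemainder p G x 0 := by
      refine mul_nonneg (by positivity) (intervalIntegral.integral_nonneg zero_le_one
        fun h hh => mul_nonneg (div_nonneg (by positivity) hh.1) (modulusOfSmoothness_nonneg X _))
    simpa using this
  obtain ⟨hcont, hint⟩ := intervalIntegrable_xuRoach hp x hy
  have main := rpow_norm_sub_le_of_dualityMap_sub_le hp (x := x) (y := y) (f := f)
    (B := fun h => G * (max ‖x - h • y‖ ‖x‖ ^ p / h *
      modulusOfSmoothness X (h * ‖y‖ / max ‖x - h • y‖ ‖x‖)))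
    (continuousOn_const.mul hcont) (hint.const_mul G) (fun h hh g hg => ?_)
  · rw [intervalIntegral.integral_const_mul] at main
    rw [xuRoachRemainder]
    linarith
  · have hM := max_norm_pos x hy hh.1
    have hM3 := half_mul_norm_le_max x y hh.1.le
    have hh0 : 0 < h := hh.1
    rw [max_comm] at hM hM3 ⊢
    have hn : ‖h • y‖ = h * ‖y‖ := by rw [norm_smul, Real.norm_of_nonneg hh0.le]
    have h1 := dualityMap_sub_apply_le hp hM hf hg (w := h • y) (t := h * ‖y‖)
      (by rw [sub_sub_cancel, hn]) hn.le
    set M := max ‖x‖ ‖x - h • y‖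
    have h2 := hρ (h * ‖y‖ / M) (by positivity) ((div_le_iff₀ hM).2 hM3)
    rw [map_smul, map_smul, smul_eq_mul, smul_eq_mul, ← mul_sub] at h1
    have h3 : (p + 4) * (h * ‖y‖ / M) ^ 2 ≤ (p + 4) / c * modulusOfSmoothness X (h * ‖y‖ / M) := by
      calc (p + 4) * (h * ‖y‖ / M) ^ 2 = (p + 4) / c * (c * (h * ‖y‖ / M) ^ 2) := by field_simp
        _ ≤ _ := by gcongr
    have h4 : h * (f y - g y) ≤ h * (G * (M ^ p / h * modulusOfSmoothness X (h * ‖y‖ / M))) := by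
      calc h * (f y - g y) ≤ M ^ p * (14 * modulusOfSmoothness X (h * ‖y‖ / M) +
            (p + 4) / c * modulusOfSmoothness X (h * ‖y‖ / M)) := h1.trans (by gcongr)
        _ = _ := by
          rw [hG]
          field_simp
    exact le_of_mul_le_mul_left h4 hh0

lemma xuRoachRemainder_le {X : Type*} [NormedAddCommGroup X] [NormedSpace ℝ X] {s p C G : ℝ}
    (hs : 1 < s) (hp : 1 < p) (hG : 0 < G)
    (hρ : ∀ ε : ℝ, 0 ≤ ε → modulusOfSmoothness X ε ≤ C * ε ^ s) (x y : X) :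
    xuRoachRemainder p G x y ≤ G * C * p * powerTypeIntegral s p x y := by
  have hmod0 : modulusOfSmoothness X 0 = 0 := le_antisymm
    (modulusOfSmoothness_le_self X le_rfl) (modulusOfSmoothness_nonneg X 0)
  rcases eq_or_ne y 0 with rfl | hy
  · simp [powerTypeIntegral_zero hs, xuRoachRemainder, hmod0]
  have hint := (intervalIntegrable_xuRoach hp x hy).2
  have hint2 := (intervalIntegrable_powerType hs hp x hy).2
  have key := intervalIntegral.integral_mono_on_of_le_Ioo zero_le_one hint (hint2.const_mul C)
    (fun h hh => ?_)
  · rw [intervalIntegral.integral_const_mul] at key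
    rw [xuRoachRemainder, powerTypeIntegral]
    refine (mul_le_mul_of_nonneg_left key (by positivity)).trans_eq ?_
    ring
  · have hM := max_norm_pos x hy hh.1
    have hh0 : 0 < h := hh.1
    set M := max ‖x - h • y‖ ‖x‖
    calc M ^ p / h * modulusOfSmoothness X (h * ‖y‖ / M)
        ≤ M ^ p / h * (C * (h * ‖y‖ / M) ^ s) := by
          gcongr
          exact hρ _ (by positivity)
      _ = C * (h ^ (s - 1) * M ^ (p - s) * ‖y‖ ^ s) := by
          rw [Real.div_rpow (by positivity) hM.le, Real.mul_rpow hh0.le (norm_nonneg _),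
            Real.rpow_sub hM, Real.rpow_sub_one hh0.ne']
          field_simp

lemma xuRoachPowerBound_of_modulusOfSmoothness_le {X : Type*} [NormedAddCommGroup X]
    [NormedSpace ℝ X] {s p C : ℝ} (hs : 1 < s) (hp : 1 < p) (hX : Module.rank ℝ X ≠ 1)
    (hC : 0 < C) (hρ : ∀ ε : ℝ, 0 ≤ ε → modulusOfSmoothness X ε ≤ C * ε ^ s) :
    XuRoachPowerBound X s p := by
  obtain ⟨G, hG, h⟩ : ∃ G : ℝ, 0 < G ∧ ∀ x y : X, ∀ f ∈ dualityMap p x,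
      ‖x - y‖ ^ p ≤ ‖x‖ ^ p - p * f y + xuRoachRemainder p G x y := by
    rcases subsingleton_or_nontrivial X with hX0 | hX0
    · refine ⟨1, one_pos, fun x y f hf => ?_⟩
      rw [Subsingleton.elim x 0, Subsingleton.elim y 0]
      simp [xuRoachRemainder, Real.zero_rpow (by linarith : p ≠ 0)]
    · refine exists_rpow_norm_sub_le_add_xuRoachRemainder hp (lt_of_le_of_ne ?_ hX.symm)
      exact Cardinal.one_le_iff_pos.2 (rank_pos_iff_nontrivial.2 hX0)
  exact ⟨G, hG, h, G * C, by positivity, xuRoachRemainder_le hs hp hG hρ⟩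

/-! ### The equivalences -/

theorem mainTheorem2 {X : Type*} [NormedAddCommGroup X] [NormedSpace ℝ X] [CompleteSpace X]
    (hX : UniformlySmooth X) (s : ℝ) (hs : 1 < s) :
    (Module.rank ℝ X ≠ 1 →
      List.TFAE
        [SmoothOfPowerType X s,
         ∃ p : ℝ, 1 < p ∧ DualityMapBound X s p,
         ∀ p : ℝ, 1 < p → DualityMapBound X s p,
         ∃ p : ℝ, 1 < p ∧ XuRoachPowerBound X s p,
         ∀ p : ℝ, 1 < p → XuRoachPowerBound X s p]) ∧
    List.TFAE
      [SmoothOfPowerType X s,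
       ∃ p : ℝ, 1 < p ∧ DualityMapBound X s p,
       ∀ p : ℝ, 1 < p → DualityMapBound X s p,
       ∃ p : ℝ, 1 < p ∧ XuRoachCombined X s p,
       ∀ p : ℝ, 1 < p → XuRoachCombined X s p] := by
  -- the exponent `p` is lost in passing through the modulus of smoothness
  have hcomb : ∀ p : ℝ, 1 < p → XuRoachCombined X s p →
      ∀ q : ℝ, 1 < q → DualityMapBound X s q := by
    intro p hp h q hq
    obtain ⟨C, hC, hρ⟩ := h.exists_modulusOfSmoothness_le hs hp
    exact dualityMapBound_of_modulusOfSmoothness_le hs hq (fun _ => h.le_two hs hp) hC hρ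
  have hb : List.TFAE
      [SmoothOfPowerType X s,
       ∃ p : ℝ, 1 < p ∧ DualityMapBound X s p,
       ∀ p : ℝ, 1 < p → DualityMapBound X s p,
       ∃ p : ℝ, 1 < p ∧ XuRoachCombined X s p,
       ∀ p : ℝ, 1 < p → XuRoachCombined X s p] := by
    rw [smoothOfPowerType_iff_xuRoachCombined hs]
    tfae_have 1 → 4 := fun h => ⟨s, hs, h⟩
    tfae_have 4 → 3 := fun ⟨p, hp, h⟩ => hcomb p hp h
    tfae_have 3 → 5 := fun h p hp => (h p hp).xuRoachCombined hs hp
    tfae_have 5 → 1 := fun h => h s hs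
    tfae_have 3 → 2 := fun h => ⟨2, one_lt_two, h 2 one_lt_two⟩
    tfae_have 2 → 4 := fun ⟨p, hp, h⟩ => ⟨p, hp, h.xuRoachCombined hs hp⟩
    tfae_finish
  refine ⟨fun hrank => ?_, hb⟩
  tfae_have 1 ↔ 2 := hb.out 0 1
  tfae_have 1 ↔ 3 := hb.out 0 2
  tfae_have 3 → 5 := by
    intro h p hp
    obtain ⟨C, hC, hρ⟩ :=
      ((h 2 one_lt_two).xuRoachCombined hs one_lt_two).exists_modulusOfSmoothness_le hs one_lt_two
    exact xuRoachPowerBound_of_modulusOfSmoothness_le hs hp hrank hC hρ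
  tfae_have 5 → 4 := fun h => ⟨2, one_lt_two, h 2 one_lt_two⟩
  tfae_have 4 → 3 := fun ⟨p, hp, h⟩ => hcomb p hp h.xuRoachCombined
  tfae_finish
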